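/- For positive integers $t,v,k,\lambda$ with $t\le k\le v$, a $t$-$(v,k,\lambda)$ design consists of a set $V$ of $v$ points and a set $B$ of $k$-subsets of $V$ (the blocks) such that every $t$-subset of $V$ is contained in exactly $\lambda$ blocks. It is nontrivial if $B$ is not the set of all $k$-subsets of $V$, and a $2s$-$(v,k,\lambda)$ design is tight if $|B|=\binom{v}{s}$. For integers $n\ge 0$ let $\ell_n:=\operatorname{lcm}\{\binom ij : 0\le j\le i\le n\}$. Let $s$ be a positive integer, let $r$ be a positive even integer with $r\le s$, and let $b$ be a real number. Write $\operatorname{val}_p$ for the $p$-adic valuation and put $$\tilde F_{s,r}:=s!\,r!\,\ell_{s-1}^2\,\ell_{s-2}^2\,(s-r+1)!\,(s-r/2+1),$$ $$\tilde G_{s,r}:=\frac{\binom{v-k-s+r/2-1}{r/2}\binom{k-r/2}{s-r/2+1}\binom{k-r}{s-r+1}}{\binom{v-s}{s}\binom{v-s-r/2}{s-r/2}},$$ $$\tilde F^b_{s,r}:=\prod_{\substack{p\text{ prime}\\ 2\le p\le b}}p^{2\lfloor\log_p(v-s)\rfloor}\prod_{\substack{p\text{ prime}\\ b<p\le s}}p^{\operatorname{val}_p(\tilde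 F_{s,r})}.$$ If there exists a nontrivial tight $2s$-$(v,k,\lambda)$ design, then $\tilde F^b_{s,r}\,\tilde G_{s,r}$ is a positive integer. -/

import Mathlib

/-- `B` is the block set of a `t`-`(v, k, lam)` design on the point set `V`: `t` and `lam` are
positive, `V` has `v` points, `t ≤ k ≤ v`, every block is a `k`-subset of `V`, and every
`t`-subset of `V` is contained in exactly `lam` blocks. -/
structure IsDesign {V : Type*} [Fintype V] [DecidableEq V] (t v k lam : ℕ)
    (B : Finset (Finset V)) : Prop where
  t_pos : 0 < t
  lam_pos : 0 < lam
  card_points : Fintype.card V = v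
  t_le_k : t ≤ k
  k_le_v : k ≤ v
  card_block : ∀ b ∈ B, b.card = k
  card_blocks_containing : ∀ T : Finset V, T.card = t → (B.filter (fun b => T ⊆ b)).card = lam

/-- `B` is the block set of a nontrivial tight `2s`-`(v, k, lam)` design on `V`: it is not the
whole collection of `k`-subsets of `V`, and it attains the Fisher type lower bound
`v.choose s` on the number of blocks. -/
structure IsNontrivialTightDesign {V : Type*} [Fintype V] [DecidableEq V] (s v k lam : ℕ)
    (B : Finset (Finset V)) : Prop where
  design : IsDesign (2 * s) v k lam B
  nontrivial : B ≠ Finset.powersetCard k Finset.univ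
  tight : B.card = v.choose s

/-- `ℓ_n = lcm {i.choose j | 0 ≤ j ≤ i ≤ n}`. -/
def ell (n : ℕ) : ℕ :=
  (Finset.range (n + 1)).lcm fun i => (Finset.range (i + 1)).lcm fun j => i.choose j

/-- The constant `s! r! ℓ_{s-1}² ℓ_{s-2}² (s - r + 1)! (s - r/2 + 1)`, used for even `r` with
`2 ≤ r ≤ s`, where no subtraction truncates. -/
def Ftilde (s r : ℕ) : ℕ :=
  s.factorial * r.factorial * ell (s - 1) ^ 2 * ell (s - 2) ^ 2 *
    (s - r + 1).factorial * (s - r / 2 + 1)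

/-- The value at `(v, k)` of the rational function
`C(v-k-s+r/2-1, r/2) C(k-r/2, s-r/2+1) C(k-r, s-r+1) / (C(v-s, s) C(v-s-r/2, s-r/2))`.
It is used for even `r` with `2 ≤ r ≤ s` and for parameters of nontrivial tight `2s`-designs.
These satisfy `2s < k` and `2s < v - k`, so no subtraction truncates. -/
def Gtilde (s r v k : ℕ) : ℚ :=
  (((v - k - s + r / 2 - 1).choose (r / 2) : ℚ) * ((k - r / 2).choose (s - r / 2 + 1) : ℚ) *
      ((k - r).choose (s - r + 1) : ℚ)) /
    (((v - s).choose s : ℚ) * ((v - s - r / 2).choose (s - r / 2) : ℚ))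

/-- The product of `p ^ (2 ⌊log_p (v - s)⌋)` over the primes `2 ≤ p ≤ b`, times the product of
`p ^ val_p (Ftilde s r)` over the primes `b < p ≤ s`. For a positive integer `p` and a real `b`,
`p ≤ ⌊b⌋₊` holds iff `p ≤ b`; and `Nat.log p n` is `⌊log_p n⌋` for `n ≥ 1`. -/
noncomputable def FtildeCap (b : ℝ) (s r v : ℕ) : ℕ :=
  (∏ p ∈ (Finset.Icc 2 ⌊b⌋₊).filter Nat.Prime, p ^ (2 * Nat.log p (v - s))) *
    ∏ p ∈ (Finset.Ioc ⌊b⌋₊ s).filter Nat.Prime, p ^ padicValNat p (Ftilde s r)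

/-!
Let `(x)_n` be the falling factorial. Fix a block `A` of a tight `2s`-design and let `x_C = |A ∩ C|`
for blocks `C`. The factorial moments of `x_C` of order at most `2s` are those of the hypergeometric
distribution (`IsDesign.sum_fall_mul_fall`). For that distribution the Wilson polynomial
`W = ∑ h, c_h (x)_h` represents, up to an explicit factor, evaluation at `k` on polynomials of degree
at most `s` (`IsDesign.sum_wilson_mul_eval`). Since `|B| = v.choose s`, this factor gives
`∑ C, W(x_C)² = W(k)²`, so `W` vanishes at `x_C` for every `C ≠ A`; and at least `s` sizes
`x_C` occur. Hence `W` is a product of `s` factors `X - x` with integers `x`, so all `c_h` are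
integers. In other words,

* `(v - s - j)_(s - j)` divides `s.choose j * (k - j)_(s - j) * (k - 1 - j)_(s - j)` for `j < s`
  (`IsNontrivialTightDesign.descFactorial_dvd`);
* `s! * (v - s)_(j + 1)` divides `(k)_(s + j + 1)`, because the number of blocks through `s + j + 1`
  points is an integer (`IsNontrivialTightDesign.factorial_mul_descFactorial_dvd`).

The rest is an argument with valuations at a prime `p`. In a product of consecutive integers the
factors other than a most divisible one contribute about as much as a factorial. Let `v - s - j` be
a most divisible factor of `(v - s)_s`, and `e` its valuation. The second divisibility provides a
number `k - m` with `0 ≤ m ≤ s + j` and valuation nearly `e`. The first one shows that `m` may be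
taken in `[j, s]`, or else that `e` is small. Both cases are summed up in
`padicValNat_sub_le_sum_min`, with a loss measured by `ell (s - 1)` and `s.choose j`. The three
binomial coefficients in the numerator of `Gtilde` are placed so that together they catch every such
`m` as often as `v - s - j` occurs in the two denominators (`padicValNat_sum_le`), because
`v - k - s + u ≡ -(k - j - u)` modulo `v - s - j`. So the denominator of `Gtilde` divides `Ftilde`
times its numerator. For the primes up to `b` the bound `p ^ val_p (n.choose m) ≤ n` for the two
denominators is enough.
-/

/-! ### Falling factorials and finite differences -/

section

open Finset Polynomial

/-- The falling factorial `x (x - 1) ⋯ (x - n + 1)` of a rational number `x`. -/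
noncomputable def fall (n : ℕ) (x : ℚ) : ℚ := (descPochhammer ℚ n).eval x

@[simp] lemma fall_zero (x : ℚ) : fall 0 x = 1 := by simp [fall]

lemma fall_succ (n : ℕ) (x : ℚ) : fall (n + 1) x = fall n x * (x - n) := by
  simp [fall, descPochhammer_succ_eval]

lemma fall_add (n m : ℕ) (x : ℚ) : fall (n + m) x = fall n x * fall m (x - n) := by
  simp [fall, ← descPochhammer_mul, eval_comp]

lemma fall_succ_left (n : ℕ) (x : ℚ) : fall (n + 1) x = x * fall n (x - 1) := by
  rw [add_comm, fall_add, fall_succ]; simp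

lemma fall_natCast (n a : ℕ) : fall n (a : ℚ) = a.descFactorial n :=
  descPochhammer_eval_eq_descFactorial ℚ a n

lemma fall_self (n : ℕ) : fall n (n : ℚ) = n.factorial := by
  rw [fall_natCast, Nat.descFactorial_self]

lemma fall_add_eq_sum (a b : ℚ) (n : ℕ) :
    fall n (a + b) = ∑ h ∈ range (n + 1), (n.choose h : ℚ) * (fall h a * fall (n - h) b) := by
  have key : ∀ (m : ℕ) (x : ℚ), (descPochhammer ℤ m).smeval x = fall m x := by
    intro m x
    rw [fall, ← descPochhammer_map (Int.castRingHom ℚ), eval_map, ← eval₂_smulOneHom_eq_smeval]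
    congr 1
    exact RingHom.ext_int _ _
  have := Ring.descPochhammer_smeval_add (r := a) (s := b) n (Commute.all a b)
  simp only [key] at this
  rw [this, Finset.Nat.sum_antidiagonal_eq_sum_range_succ_mk]

/-- Reversal of a falling factorial: `(n - x)_n = (-1) ^ n (x - 1)_n`. -/
lemma fall_reverse (n : ℕ) (x : ℚ) : fall n (n - x) = (-1) ^ n * fall n (x - 1) := by
  induction n generalizing x with
  | zero => simp
  | succ n ih =>
    have h1 : ((n + 1 : ℕ) : ℚ) - x - 1 = n - x := by push_cast; ring
    rw [fall_succ_left, h1, ih, fall_succ, pow_succ]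
    push_cast; ring

/-- The sum is the `n`-th finite difference at `0` of a polynomial of degree less than `n`. -/
lemma alternating_sum_polynomial {n : ℕ} {P : ℚ[X]} (hP : P.natDegree < n) :
    ∑ h ∈ range (n + 1), (-1 : ℚ) ^ (n - h) * n.choose h * P.eval (h : ℚ) = 0 := by
  have h1 := congrFun (Polynomial.fwdDiff_iter_eq_zero_of_degree_lt hP) 0
  rw [fwdDiff_iter_eq_sum_shift] at h1
  simpa using h1

/-- The partial fraction expansion of `n! / (y (y - 1) ⋯ (y - n))`. -/
lemma alternating_sum_inv {n : ℕ} {y : ℚ} (hy : ∀ h : ℕ, h ≤ n → y ≠ h) :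
    ∑ h ∈ range (n + 1), (-1 : ℚ) ^ (n - h) * n.choose h * (y - h)⁻¹
      = n.factorial / fall (n + 1) y := by
  have key : ∀ (n x : ℕ), (∀ h : ℕ, h ≤ x + n → y ≠ h) →
      (fwdDiff 1)^[n] (fun x : ℕ => (y - x)⁻¹) x = n.factorial / fall (n + 1) (y - x) := by
    intro n
    induction n with
    | zero => intro x _; simp [fall_succ]
    | succ n ih =>
      intro x hx
      have h0 : ∀ m : ℕ, m ≤ n → fall m (y - x - 1) ≠ 0 := by
        intro m
        induction m with
        | zero => simp
        | succ m ihm =>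
          intro hm
          rw [fall_succ]
          refine mul_ne_zero (ihm (by omega)) fun h => hx (x + 1 + m) (by omega) ?_
          push_cast; linarith
      have h1 : y - x ≠ 0 := sub_ne_zero.2 (hx x (by omega))
      have h2 : y - x - 1 - n ≠ 0 := fun h => hx (x + 1 + n) (by omega) (by push_cast; linarith)
      have h3 := h0 n le_rfl
      have e1 : y - ((x + 1 : ℕ) : ℚ) = y - x - 1 := by push_cast; ring
      rw [Function.iterate_succ_apply', fwdDiff, ih x fun h hh => hx h (by omega),
        ih (x + 1) fun h hh => hx h (by omega), e1, fall_succ_left (n + 1),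
        fall_succ_left n (y - x), fall_succ n (y - x - 1), Nat.factorial_succ]
      push_cast
      field_simp
      ring
  have h1 := key n 0 (by simpa using hy)
  rw [fwdDiff_iter_eq_sum_shift] at h1
  simpa using h1

/-- Lagrange interpolation of `P` at the nodes `0, …, n`, evaluated at `y`. -/
lemma alternating_sum_div {n : ℕ} {P : ℚ[X]} (hP : P.natDegree ≤ n) {y : ℚ}
    (hy : ∀ h : ℕ, h ≤ n → y ≠ h) :
    ∑ h ∈ range (n + 1), (-1 : ℚ) ^ (n - h) * n.choose h * (P.eval (h : ℚ) / (y - h))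
      = n.factorial * P.eval y / fall (n + 1) y := by
  obtain ⟨Q, hQ⟩ : X - C y ∣ P - C (P.eval y) := by
    rw [dvd_iff_isRoot]; simp
  have hsum : ∑ h ∈ range (n + 1), (-1 : ℚ) ^ (n - h) * n.choose h * Q.eval (h : ℚ) = 0 := by
    by_cases hQ0 : Q = 0
    · simp [hQ0]
    apply alternating_sum_polynomial
    have h1 : (P - C (P.eval y)).natDegree = Q.natDegree + 1 := by
      rw [hQ, (monic_X_sub_C y).natDegree_mul' hQ0, natDegree_X_sub_C, add_comm]
    have h2 : (P - C (P.eval y)).natDegree ≤ n := by simpa using hP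
    omega
  have hP' : ∀ h ∈ range (n + 1), (-1 : ℚ) ^ (n - h) * n.choose h * (P.eval (h : ℚ) / (y - h))
      = P.eval y * ((-1 : ℚ) ^ (n - h) * n.choose h * (y - h)⁻¹)
        - (-1 : ℚ) ^ (n - h) * n.choose h * Q.eval (h : ℚ) := by
    intro h hh
    have h1 : y - h ≠ 0 := sub_ne_zero.2 (hy h (by simpa [Nat.lt_succ_iff] using hh))
    have h2 := congrArg (eval (h : ℚ)) hQ
    simp only [eval_sub, eval_C, eval_mul, eval_X] at h2
    have h3 : P.eval (h : ℚ) = P.eval y + (h - y) * Q.eval (h : ℚ) := by linarith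
    rw [h3]
    field_simp
    ring
  rw [sum_congr rfl hP', sum_sub_distrib, ← mul_sum, alternating_sum_inv hy, hsum]
  ring

/-- Falling factorials are monic, so they form a basis of the polynomials over any domain; over
`ℤ` this makes the coefficients of the expansion integers. -/
lemma exists_eq_sum_descPochhammer {R : Type*} [CommRing R] [IsDomain R] (N : ℕ) (P : R[X])
    (hP : P.natDegree ≤ N) :
    ∃ d : ℕ → R, P = ∑ j ∈ range (N + 1), C (d j) * descPochhammer R j := by
  induction N generalizing P with
  | zero =>
    refine ⟨fun _ => P.coeff 0, ?_⟩
    simpa using eq_C_of_natDegree_le_zero hP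
  | succ N ih =>
    have hm := monic_descPochhammer R (N + 1)
    have hd := descPochhammer_natDegree R (N + 1)
    obtain ⟨d, hd2⟩ := ih (P - C (P.coeff (N + 1)) * descPochhammer R (N + 1)) (by
      rw [natDegree_le_iff_coeff_eq_zero]
      intro m hm'
      rcases (Nat.succ_le_of_lt hm').eq_or_lt with rfl | hlt
      · have : (descPochhammer R (N + 1)).coeff (N + 1) = 1 := by
          have := hm.coeff_natDegree
          rwa [hd] at this
        simp [this]
      · rw [coeff_sub, coeff_C_mul, coeff_eq_zero_of_natDegree_lt (lt_of_le_of_lt hP hlt),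
          coeff_eq_zero_of_natDegree_lt (p := descPochhammer R (N + 1)) (by rw [hd]; exact hlt)]
        simp)
    refine ⟨fun j => if j = N + 1 then P.coeff (N + 1) else d j, ?_⟩
    rw [sum_range_succ]
    have : ∑ j ∈ range (N + 1), C (if j = N + 1 then P.coeff (N + 1) else d j) *
        descPochhammer R j = ∑ j ∈ range (N + 1), C (d j) * descPochhammer R j :=
      sum_congr rfl fun j hj => by rw [if_neg (by have := mem_range.1 hj; omega)]
    rw [this, ← hd2]
    simp

lemma sum_fall_coeff_unique {N : ℕ} {d e : ℕ → ℚ}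
    (h : ∀ x : ℚ, ∑ j ∈ range (N + 1), d j * fall j x = ∑ j ∈ range (N + 1), e j * fall j x)
    {m : ℕ} (hm : m ≤ N) : d m = e m := by
  induction m using Nat.strong_induction_on with
  | _ m ih =>
    have h1 := h m
    have aux : ∀ f : ℕ → ℚ, ∑ j ∈ range (N + 1), f j * fall j (m : ℚ)
        = ∑ j ∈ range (m + 1), f j * fall j (m : ℚ) := by
      intro f
      refine (sum_subset (range_subset_range.2 (by omega)) fun j _ hj => ?_).symm
      rw [fall_natCast, Nat.descFactorial_eq_zero_iff_lt.2 (by simpa using hj)]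
      simp
    rw [aux, aux, sum_range_succ, sum_range_succ, sum_congr rfl fun j hj => by
      rw [ih j (mem_range.1 hj) (by have := mem_range.1 hj; omega)]] at h1
    have h2 : fall m (m : ℚ) ≠ 0 := by rw [fall_self]; exact_mod_cast m.factorial_ne_zero
    exact mul_right_cancel₀ h2 (add_left_cancel h1)

end

/-! ### Intersection moments of a design and the Wilson polynomial -/

section Design

open Finset Polynomial

variable {V : Type*} [Fintype V] [DecidableEq V] {B : Finset (Finset V)} {t v k lam : ℕ}

lemma sum_card_filter_insert_subset (hB : ∀ b ∈ B, b.card = k) (H : Finset V) :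
    ∑ y ∈ univ \ H, (B.filter (fun b => insert y H ⊆ b)).card
      = (B.filter (fun b => H ⊆ b)).card * (k - H.card) := by
  simp_rw [card_filter]
  rw [sum_comm, sum_mul]
  refine sum_congr rfl fun b hb => ?_
  by_cases h : H ⊆ b
  · rw [if_pos h, one_mul, ← card_filter, ← hB b hb, ← card_sdiff_of_subset h]
    congr 1
    ext y
    simp only [mem_filter, mem_sdiff, mem_univ, true_and, insert_subset_iff]
    tauto
  · rw [if_neg h, zero_mul]
    exact sum_eq_zero fun y _ => if_neg fun h' => h ((subset_insert _ _).trans h')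

/-- A `t`-design is an `h`-design for every `h ≤ t`. -/
lemma IsDesign.exists_card_filter_subset (hd : IsDesign t v k lam B) {h : ℕ} (ht : h ≤ t) :
    ∃ μ, ∀ H : Finset V, H.card = h → (B.filter (fun b => H ⊆ b)).card = μ := by
  induction ht using Nat.decreasingInduction with
  | self => exact ⟨lam, hd.card_blocks_containing⟩
  | of_succ h hlt ih =>
    obtain ⟨μ, hμ⟩ := ih
    refine ⟨(v - h) * μ / (k - h), fun H hH => ?_⟩
    have h1 := sum_card_filter_insert_subset hd.card_block H
    rw [sum_congr rfl fun y hy => hμ (insert y H) (by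
      rw [card_insert_of_notMem (mem_sdiff.1 hy).2, hH]), sum_const, card_univ_sdiff,
      hd.card_points, hH, smul_eq_mul] at h1
    have := hd.t_le_k
    rw [h1, Nat.mul_div_cancel _ (by omega)]

lemma IsDesign.card_filter_subset_mul (hd : IsDesign t v k lam B) {h : ℕ} (ht : h ≤ t)
    (H : Finset V) (hH : H.card = h) :
    (B.filter (fun b => H ⊆ b)).card * v.descFactorial h = B.card * k.descFactorial h := by
  induction h generalizing H with
  | zero => simp [card_eq_zero.1 hH]
  | succ h ih =>
    obtain ⟨μ, hμ⟩ := hd.exists_card_filter_subset ht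
    obtain ⟨y, H', hy, rfl, hH'⟩ := card_eq_succ.1 hH
    have h1 := sum_card_filter_insert_subset hd.card_block H'
    rw [sum_congr rfl fun z hz => hμ (insert z H') (by
      rw [card_insert_of_notMem (mem_sdiff.1 hz).2, hH']), sum_const, card_univ_sdiff,
      hd.card_points, hH', smul_eq_mul] at h1
    have h2 := ih (by omega) H' hH'
    rw [hμ _ hH, Nat.descFactorial_succ, Nat.descFactorial_succ]
    calc μ * ((v - h) * v.descFactorial h) = (v - h) * μ * v.descFactorial h := by ring
      _ = (B.filter (fun b => H' ⊆ b)).card * v.descFactorial h * (k - h) := by rw [h1]; ring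
      _ = _ := by rw [h2]; ring

lemma IsDesign.sum_descFactorial_inter (hd : IsDesign t v k lam B) {h : ℕ} (ht : h ≤ t)
    (A : Finset V) (hA : A.card = k) :
    (∑ b ∈ B, (A ∩ b).card.descFactorial h) * v.descFactorial h
      = B.card * k.descFactorial h * k.descFactorial h := by
  have h1 : ∀ b : Finset V, (A ∩ b).card.descFactorial h
      = h.factorial * ∑ H ∈ powersetCard h A, if H ⊆ b then 1 else 0 := by
    intro b
    rw [Nat.descFactorial_eq_factorial_mul_choose, ← card_powersetCard, ← card_filter]
    congr 2
    ext H
    simp only [mem_filter, mem_powersetCard, subset_inter_iff]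
    tauto
  simp_rw [h1]
  rw [← mul_sum, sum_comm]
  simp_rw [← card_filter]
  rw [mul_assoc, sum_mul, sum_congr rfl fun H hH =>
    hd.card_filter_subset_mul ht H (mem_powersetCard.1 hH).2, sum_const, card_powersetCard, hA,
    smul_eq_mul, k.descFactorial_eq_factorial_mul_choose h]
  ring

/-- In a design the mixed factorial moments of the intersection size with a fixed `k`-set `A`
agree with those of a uniformly random `k`-set, as long as their order is at most `t`. -/
lemma IsDesign.sum_fall_mul_fall (hd : IsDesign t v k lam B) {h u : ℕ} (hu : h + u ≤ t)
    (A : Finset V) (hA : A.card = k) :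
    (∑ b ∈ B, fall h ((A ∩ b).card : ℚ) * fall u (k - (A ∩ b).card)) * fall (h + u) v
      = B.card * fall (h + u) k * fall h k * fall u (v - k) := by
  induction u generalizing h with
  | zero =>
    have := hd.sum_descFactorial_inter hu A hA
    simp only [fall_zero, mul_one, add_zero, fall_natCast]
    exact_mod_cast this
  | succ u ih =>
    have h1 := ih (h := h) (by omega)
    have h2 := ih (h := h + 1) (by omega)
    have e : ∀ x : ℚ, fall h x * fall (u + 1) (k - x)
        = (k - h - u) * (fall h x * fall u (k - x)) - fall (h + 1) x * fall u (k - x) := by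
      intro x; rw [fall_succ, fall_succ]; ring
    simp_rw [e]
    rw [sum_sub_distrib, ← mul_sum, sub_mul]
    have e2 : h + 1 + u = h + u + 1 := by ring
    rw [e2] at h2
    rw [← add_assoc, h2, fall_succ (h + u) v, fall_succ (h + u) k, fall_succ u, fall_succ h]
    push_cast
    linear_combination (k - h - u : ℚ) * (v - h - u) * h1

/-- The coefficient of the `h`-th falling factorial in the monic Wilson polynomial. -/
noncomputable def wilsonCoeff (n v k h : ℕ) : ℚ :=
  (-1) ^ (n - h) * n.choose h * fall (n - h) (k - h) * fall (n - h) (k - 1 - h)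
    / fall (n - h) (v - n - h)

/-- The monic Wilson polynomial of degree `n`: among polynomials of degree at most `n`, it
represents, up to a scalar, evaluation at `k` with respect to the hypergeometric distribution of
the intersection size of two random `k`-subsets of a `v`-set. -/
noncomputable def wilson (n v k : ℕ) : ℚ[X] :=
  ∑ h ∈ range (n + 1), C (wilsonCoeff n v k h) * descPochhammer ℚ h

lemma wilson_eval (n v k : ℕ) (x : ℚ) :
    (wilson n v k).eval x = ∑ h ∈ range (n + 1), wilsonCoeff n v k h * fall h x := by
  simp [wilson, eval_finsetSum, fall]

lemma wilsonCoeff_self (n v k : ℕ) : wilsonCoeff n v k n = 1 := by simp [wilsonCoeff]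

lemma degree_wilson_sub_lt (n v k : ℕ) : (wilson n v k - descPochhammer ℚ n).degree < n := by
  rw [wilson, sum_range_succ, wilsonCoeff_self, C_1, one_mul, add_sub_cancel_right]
  rw [← mem_degreeLT]
  refine Submodule.sum_mem _ fun h hh => ?_
  rw [← smul_eq_C_mul]
  refine Submodule.smul_mem _ _ (mem_degreeLT.2 ?_)
  rw [degree_eq_natDegree (monic_descPochhammer ℚ h).ne_zero, descPochhammer_natDegree]
  exact_mod_cast mem_range.1 hh

lemma natDegree_wilson_le (n v k : ℕ) : (wilson n v k).natDegree ≤ n := by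
  refine natDegree_sum_le_of_forall_le _ _ fun h hh => ?_
  refine (natDegree_C_mul_le _ _).trans ?_
  rw [descPochhammer_natDegree]
  exact Nat.lt_succ_iff.1 (mem_range.1 hh)

lemma fall_nat_ne_zero {n v : ℕ} (h : n ≤ v) : fall n (v : ℚ) ≠ 0 := by
  rw [fall_natCast]
  exact_mod_cast fun h' => absurd (Nat.descFactorial_eq_zero_iff_lt.1 h') (by omega)

lemma fall_mul_fall_sub {n h : ℕ} (hh : h ≤ n) (x : ℚ) :
    fall h x * fall (n - h) (x - h) = fall n x := by
  rw [← fall_add, Nat.add_sub_cancel' hh]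

/-- The value at `k` of the Wilson polynomial, by the Chu-Vandermonde identity. -/
lemma wilson_eval_k {n v k : ℕ} (hv : 2 * n ≤ v) :
    (wilson n v k).eval (k : ℚ) = fall n k * fall n (v - k) / fall n (v - n) := by
  have hcast : ((v : ℚ) - n) = ((v - n : ℕ) : ℚ) := by rw [Nat.cast_sub (by omega)]
  have hne : fall n ((v : ℚ) - n) ≠ 0 := by rw [hcast]; exact fall_nat_ne_zero (by omega)
  rw [wilson_eval, eq_div_iff hne, sum_mul]
  have h1 := fall_add_eq_sum ((v : ℚ) - n) (n - k) n
  rw [show (v : ℚ) - n + (n - k) = v - k by ring] at h1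
  rw [h1, mul_sum]
  refine sum_congr rfl fun h hh => ?_
  have hh : h ≤ n := Nat.lt_succ_iff.1 (mem_range.1 hh)
  have h2 : fall (n - h) ((n : ℚ) - k) = (-1) ^ (n - h) * fall (n - h) (k - 1 - h) := by
    have := fall_reverse (n - h) ((k : ℚ) - h)
    rw [Nat.cast_sub hh, show (n : ℚ) - h - (k - h) = n - k by ring] at this
    rw [this, show (k : ℚ) - h - 1 = k - 1 - h by ring]
  have h3 := fall_mul_fall_sub hh ((v : ℚ) - n)
  have h4 : fall (n - h) ((v : ℚ) - n - h) ≠ 0 := fun h0 => hne (by rw [← h3, h0, mul_zero])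
  rw [h2, ← h3, ← fall_mul_fall_sub hh (k : ℚ), wilsonCoeff]
  field_simp

lemma natDegree_descPochhammer_comp_le (m : ℕ) (c : ℚ) :
    ((descPochhammer ℚ m).comp (C c - X)).natDegree ≤ m := by
  refine natDegree_comp_le.trans ?_
  rw [descPochhammer_natDegree]
  have : (C c - X : ℚ[X]).natDegree ≤ 1 :=
    (natDegree_sub_le _ _).trans (by simp)
  nlinarith

lemma IsDesign.sum_wilson_mul_fall_eq (hd : IsDesign t v k lam B) {n u : ℕ} (hn : 2 * n ≤ t)
    (hu : u ≤ n) (A : Finset V) (hA : A.card = k) :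
    ∑ b ∈ B, (wilson n v k).eval ((A ∩ b).card : ℚ) * fall u (k - (A ∩ b).card)
      = ∑ h ∈ range (n + 1), wilsonCoeff n v k h *
        (B.card * fall (h + u) k * fall h k * fall u (v - k) / fall (h + u) v) := by
  simp_rw [wilson_eval, sum_mul]
  rw [sum_comm]
  refine sum_congr rfl fun h hh => ?_
  have hh : h ≤ n := Nat.lt_succ_iff.1 (mem_range.1 hh)
  have hkt := hd.t_le_k
  have hvk := hd.k_le_v
  rw [← hd.sum_fall_mul_fall (h := h) (u := u) (by omega) A hA,
    mul_div_cancel_right₀ _ (fall_nat_ne_zero (by omega)), mul_sum]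
  exact sum_congr rfl fun b _ => by ring

lemma fall_den {n h u : ℕ} (hh : h ≤ n) (hu : u ≤ n) (x : ℚ) :
    fall (2 * n) x = fall (h + u) x * fall (n - u) (x - u - h) * fall (n - h) (x - n - h) := by
  have h1 : 2 * n = h + u + (n - u) + (n - h) := by omega
  rw [h1, fall_add, fall_add]
  push_cast [Nat.cast_sub hu]
  rw [show x - (h + u + (n - u)) = x - n - h by ring, show x - ((h : ℚ) + u) = x - u - h by ring]

/-- The Wilson polynomial is orthogonal to the polynomials `(k - x)_u` with `1 ≤ u ≤ n`, all of
which vanish at `k`. -/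
lemma IsDesign.sum_wilson_mul_fall_eq_zero (hd : IsDesign t v k lam B) {n u : ℕ}
    (hn : 2 * n ≤ t) (hu0 : 1 ≤ u) (hu : u ≤ n) (A : Finset V) (hA : A.card = k) :
    ∑ b ∈ B, (wilson n v k).eval ((A ∩ b).card : ℚ) * fall u (k - (A ∩ b).card) = 0 := by
  rw [hd.sum_wilson_mul_fall_eq hn hu A hA]
  -- up to a common factor, the summands are alternating binomial terms of a polynomial of degree
  -- `(u - 1) + (n - u) < n`
  have hkt := hd.t_le_k
  have hvk := hd.k_le_v
  have h0 : ∑ h ∈ range (n + 1), (-1 : ℚ) ^ (n - h) * n.choose h *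
      (fall (u - 1) (k - 1 - h) * fall (n - u) (v - u - h)) = 0 := by
    have hPd : ((descPochhammer ℚ (u - 1)).comp (C ((k : ℚ) - 1) - X) *
        (descPochhammer ℚ (n - u)).comp (C ((v : ℚ) - u) - X)).natDegree < n := by
      refine natDegree_mul_le.trans_lt ?_
      have h1 := natDegree_descPochhammer_comp_le (u - 1) ((k : ℚ) - 1)
      have h2 := natDegree_descPochhammer_comp_le (n - u) ((v : ℚ) - u)
      omega
    have h0 := alternating_sum_polynomial hPd
    simpa only [eval_mul, eval_comp, eval_sub, eval_C, eval_X, fall] using h0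
  rw [← mul_zero (B.card * fall u (v - k) * fall n k * fall (n + 1) k / fall (2 * n) v : ℚ), ← h0,
    mul_sum]
  refine sum_congr rfl fun h hh => ?_
  have hh : h ≤ n := Nat.lt_succ_iff.1 (mem_range.1 hh)
  have h2n := fall_den hh hu (v : ℚ)
  have hne : fall (2 * n) (v : ℚ) ≠ 0 := fall_nat_ne_zero (by omega)
  have hne1 : fall (h + u) (v : ℚ) ≠ 0 := fun h0 => hne (by rw [h2n, h0]; ring)
  have hne2 : fall (n - h) ((v : ℚ) - n - h) ≠ 0 := fun h0 => hne (by rw [h2n, h0]; ring)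
  have hne3 : fall (n - u) ((v : ℚ) - u - h) ≠ 0 := fun h0 => hne (by rw [h2n, h0]; ring)
  have e1 : fall (h + u) (k : ℚ) = fall (h + 1) k * fall (u - 1) (k - 1 - h) := by
    rw [show h + u = h + 1 + (u - 1) by omega, fall_add]
    push_cast
    rw [show (k : ℚ) - (h + 1) = k - 1 - h by ring]
  have e2 : fall (n + 1) (k : ℚ) = fall (h + 1) k * fall (n - h) (k - 1 - h) := by
    rw [show n + 1 = h + 1 + (n - h) by omega, fall_add]
    push_cast
    rw [show (k : ℚ) - (h + 1) = k - 1 - h by ring]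
  rw [h2n, e1, e2, ← fall_mul_fall_sub hh (k : ℚ), wilsonCoeff]
  generalize fall (h + u) (v : ℚ) = D₁ at *
  generalize fall (n - h) ((v : ℚ) - n - h) = D₂ at *
  generalize fall (n - u) ((v : ℚ) - u - h) = D₃ at *
  generalize fall (h + 1) (k : ℚ) = K₁
  generalize fall (u - 1) ((k : ℚ) - 1 - h) = K₂
  generalize fall (n - h) ((k : ℚ) - 1 - h) = K₃
  generalize (-1 : ℚ) ^ (n - h) = ε
  field_simp

/-- The sum of the Wilson polynomial over the intersection sizes, computed by Lagrange interpolation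
of `(v - x)_n` at the nodes `0, …, n`. -/
lemma IsDesign.sum_wilson (hd : IsDesign t v k lam B) {n : ℕ}
    (hn : 2 * n ≤ t) (hnk : n < k) (A : Finset V) (hA : A.card = k) :
    (∑ b ∈ B, (wilson n v k).eval ((A ∩ b).card : ℚ)) * v.choose n
      = B.card * (wilson n v k).eval (k : ℚ) := by
  have hkt := hd.t_le_k
  have hvk := hd.k_le_v
  have h1 := hd.sum_wilson_mul_fall_eq hn (Nat.zero_le n) A hA
  simp only [fall_zero, mul_one, add_zero] at h1
  set P : ℚ[X] := (descPochhammer ℚ n).comp (C (v : ℚ) - X) with hP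
  have hPe : ∀ x : ℚ, P.eval x = fall n (v - x) := by
    intro x; simp [hP, eval_comp, fall]
  have h0 := alternating_sum_div (natDegree_descPochhammer_comp_le n (v : ℚ)) (y := (k : ℚ))
    fun h hh => by exact_mod_cast (by omega : k ≠ h)
  simp only [← hP, hPe] at h0
  have hne : fall (2 * n) (v : ℚ) ≠ 0 := fall_nat_ne_zero (by omega)
  have hk : fall (n + 1) (k : ℚ) ≠ 0 := fall_nat_ne_zero (by omega)
  have h2 : ∑ b ∈ B, (wilson n v k).eval ((A ∩ b).card : ℚ)
      = B.card * fall n k * fall (n + 1) k / fall (2 * n) v *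
        (n.factorial * fall n (v - k) / fall (n + 1) k) := by
    rw [h1, ← h0, mul_sum]
    refine sum_congr rfl fun h hh => ?_
    have hh : h ≤ n := Nat.lt_succ_iff.1 (mem_range.1 hh)
    have h2n := fall_den hh (Nat.zero_le n) (v : ℚ)
    simp only [Nat.cast_zero, sub_zero, add_zero, Nat.sub_zero] at h2n
    have hne1 : fall h (v : ℚ) ≠ 0 := fun h0 => hne (by rw [h2n, h0]; ring)
    have hne2 : fall (n - h) ((v : ℚ) - n - h) ≠ 0 := fun h0 => hne (by rw [h2n, h0]; ring)
    have hne3 : fall n ((v : ℚ) - h) ≠ 0 := fun h0 => hne (by rw [h2n, h0]; ring)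
    have hkh : (k : ℚ) - h ≠ 0 := sub_ne_zero.2 (by exact_mod_cast (by omega : k ≠ h))
    have e2 : fall (n + 1) (k : ℚ) = fall h k * (k - h) * fall (n - h) (k - 1 - h) := by
      rw [show n + 1 = h + 1 + (n - h) by omega, fall_add, fall_succ]
      push_cast
      rw [show (k : ℚ) - (h + 1) = k - 1 - h by ring]
    rw [h2n, e2, ← fall_mul_fall_sub hh (k : ℚ), wilsonCoeff]
    field_simp
  have h3 : (v.choose n : ℚ) * n.factorial = fall n v := by
    rw [fall_natCast, Nat.descFactorial_eq_factorial_mul_choose]; push_cast; ring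
  have h4 : fall (2 * n) (v : ℚ) = fall n v * fall n (v - n) := by
    rw [two_mul, fall_add]
  have hne1 : fall n (v : ℚ) ≠ 0 := fun h0 => hne (by rw [h4, h0]; ring)
  have hne2 : fall n ((v : ℚ) - n) ≠ 0 := fun h0 => hne (by rw [h4, h0]; ring)
  rw [h2, wilson_eval_k (by omega), h4, ← h3] at *
  have hf : (n.factorial : ℚ) ≠ 0 := by exact_mod_cast n.factorial_ne_zero
  have hc : (v.choose n : ℚ) ≠ 0 := fun h0 => hne1 (by rw [h0]; ring)
  field_simp

/-- The Wilson polynomial represents evaluation at `k`, up to the factor `|B| / v.choose n`. -/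
lemma IsDesign.sum_wilson_mul_eval (hd : IsDesign t v k lam B) {n : ℕ}
    (hn : 2 * n ≤ t) (hnk : n < k) (A : Finset V) (hA : A.card = k) (g : ℚ[X])
    (hg : g.natDegree ≤ n) :
    (∑ b ∈ B, (wilson n v k).eval ((A ∩ b).card : ℚ) * g.eval ((A ∩ b).card : ℚ)) * v.choose n
      = B.card * (wilson n v k).eval (k : ℚ) * g.eval (k : ℚ) := by
  obtain ⟨d, hd2⟩ := exists_eq_sum_descPochhammer n (g.comp (C (k : ℚ) - X)) (by
    refine natDegree_comp_le.trans ?_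
    have : (C (k : ℚ) - X : ℚ[X]).natDegree ≤ 1 := (natDegree_sub_le _ _).trans (by simp)
    nlinarith)
  have hge : ∀ x : ℚ, g.eval x = ∑ j ∈ range (n + 1), d j * fall j (k - x) := by
    intro x
    have := congrArg (eval ((k : ℚ) - x)) hd2
    simpa [eval_comp, eval_finsetSum, fall] using this
  simp_rw [hge, mul_sum]
  rw [sum_comm, sum_mul]
  refine sum_congr rfl fun j hj => ?_
  have hj : j ≤ n := Nat.lt_succ_iff.1 (mem_range.1 hj)
  have e : ∑ b ∈ B, (wilson n v k).eval ((A ∩ b).card : ℚ) * (d j * fall j (k - (A ∩ b).card))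
      = d j * ∑ b ∈ B, (wilson n v k).eval ((A ∩ b).card : ℚ) * fall j (k - (A ∩ b).card) := by
    rw [mul_sum]; exact sum_congr rfl fun b _ => by ring
  rw [e]
  rcases Nat.eq_zero_or_pos j with rfl | hj0
  · simp only [fall_zero, mul_one]
    rw [mul_assoc, hd.sum_wilson hn hnk A hA]; ring
  · rw [hd.sum_wilson_mul_fall_eq_zero hn hj0 hj A hA, sub_self]
    obtain ⟨m, rfl⟩ := Nat.exists_eq_add_of_lt hj0
    rw [zero_add, fall_succ_left]; ring

end Design

/-! ### Divisibility conditions for tight designs -/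

section TightDesign

open Finset Polynomial

lemma choose_lt_choose_of_lt_of_two_mul_le {n s v : ℕ} (hn : n < s) (hv : 2 * s ≤ v) :
    v.choose n < v.choose s := by
  induction s, hn using Nat.le_induction with
  | base =>
    have h1 := Nat.choose_succ_right_eq v n
    have h2 : 0 < v.choose n := Nat.choose_pos (by omega)
    have h3 : n + 1 < v - n := by omega
    by_contra hle
    nlinarith
  | succ m hm ih =>
    exact (ih (by omega)).trans_le (Nat.choose_le_succ_of_lt_half_left (by omega))

variable {V : Type*} [Fintype V] [DecidableEq V] {B : Finset (Finset V)} {s v k lam : ℕ}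

/-- Otherwise there would be at most `v.choose s` subsets of size `k` in all, and so fewer blocks
than that. -/
lemma IsNontrivialTightDesign.lt_sub (hd : IsNontrivialTightDesign s v k lam B) :
    s < v - k := by
  by_contra hle
  have h1 : B.card < v.choose k := by
    rw [← hd.design.card_points, ← card_univ, ← card_powersetCard]
    refine card_lt_card (lt_of_le_of_ne (fun b hb => ?_) hd.nontrivial)
    exact mem_powersetCard.2 ⟨subset_univ _, hd.design.card_block b hb⟩
  have hk := hd.design.k_le_v
  have ht := hd.design.t_le_k
  rw [hd.tight, ← Nat.choose_symm hk] at h1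
  rcases (not_lt.1 hle).eq_or_lt with h | h
  · rw [h] at h1; exact lt_irrefl _ h1
  · exact lt_asymm h1 (choose_lt_choose_of_lt_of_two_mul_le h (by omega))

/-- In a tight design the Wilson polynomial vanishes at every intersection size of two distinct
blocks: its squares at the intersection sizes with `A` sum to its square at `k`. -/
lemma IsNontrivialTightDesign.wilson_eval_eq_zero (hd : IsNontrivialTightDesign s v k lam B)
    {A b : Finset V} (hA : A ∈ B) (hb : b ∈ B) (hAb : b ≠ A) :
    (wilson s v k).eval ((A ∩ b).card : ℚ) = 0 := by
  have ht := hd.design.t_le_k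
  have ht0 := hd.design.t_pos
  have hAk := hd.design.card_block A hA
  have hkv := hd.design.k_le_v
  have h1 := hd.design.sum_wilson_mul_eval le_rfl (by omega) A hAk (wilson s v k)
    (natDegree_wilson_le s v k)
  have hc : (v.choose s : ℚ) ≠ 0 := by exact_mod_cast (Nat.choose_pos (by omega)).ne'
  have h2 : ∑ b ∈ B, (wilson s v k).eval ((A ∩ b).card : ℚ) ^ 2
      = (wilson s v k).eval (k : ℚ) ^ 2 := by
    apply mul_right_cancel₀ hc
    rw [hd.tight] at h1
    simp only [pow_two]
    linear_combination h1
  rw [← add_sum_erase B _ hA, inter_self, hAk, add_eq_left,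
    sum_eq_zero_iff_of_nonneg fun _ _ => sq_nonneg _] at h2
  exact pow_eq_zero_iff two_ne_zero |>.1 (h2 b (mem_erase.2 ⟨hAb, hb⟩))

/-- Blocks of a tight `2s`-design meet a fixed block in at least `s` different sizes: fewer sizes
would force `|B| = v.choose n` with `n < s`. -/
lemma IsNontrivialTightDesign.le_card_image (hd : IsNontrivialTightDesign s v k lam B)
    {A : Finset V} (hA : A ∈ B) : s ≤ ((B.erase A).image fun b => (A ∩ b).card).card := by
  by_contra hlt
  rw [not_le] at hlt
  set X := (B.erase A).image fun b => (A ∩ b).card with hX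
  have ht := hd.design.t_le_k
  have hkv := hd.design.k_le_v
  have hvk := hd.lt_sub
  have hAk := hd.design.card_block A hA
  have hg : ∀ x : ℚ, (∏ y ∈ X, (Polynomial.X - C (y : ℚ))).eval x = ∏ y ∈ X, (x - y) := by
    intro x; simp [eval_prod]
  -- test against the polynomial that vanishes at all sizes of intersections with other blocks
  have h1 := hd.design.sum_wilson_mul_eval (n := X.card) (by omega) (by omega) A hAk
    (∏ y ∈ X, (Polynomial.X - C (y : ℚ))) (by rw [natDegree_finsetProd_X_sub_C_eq_card])
  have hg0 : ∏ y ∈ X, ((k : ℚ) - y) ≠ 0 := by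
    refine prod_ne_zero_iff.2 fun y hy => sub_ne_zero.2 ?_
    obtain ⟨b, hb, rfl⟩ := mem_image.1 hy
    obtain ⟨hbA, hb⟩ := mem_erase.1 hb
    intro h
    have h2 : k = (A ∩ b).card := by exact_mod_cast h
    have h3 : A ∩ b = A := eq_of_subset_of_card_le inter_subset_left (by omega)
    have hbk := hd.design.card_block b hb
    have h4 : A = b := eq_of_subset_of_card_le (inter_eq_left.1 h3) (by omega)
    exact hbA h4.symm
  have hW : (wilson X.card v k).eval (k : ℚ) ≠ 0 := by
    rw [wilson_eval_k (by omega)]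
    refine div_ne_zero (mul_ne_zero (fall_nat_ne_zero (by omega)) ?_) ?_
    · rw [← Nat.cast_sub hkv]; exact fall_nat_ne_zero (by omega)
    · rw [← Nat.cast_sub (by omega)]; exact fall_nat_ne_zero (by omega)
  simp only [hg] at h1
  rw [← add_sum_erase B _ hA, sum_eq_zero (s := B.erase A) fun b hb =>
    mul_eq_zero_of_right _ (prod_eq_zero (mem_image_of_mem _ hb) (sub_self _)), inter_self, hAk,
    add_zero, hd.tight, mul_assoc] at h1
  have h2 : (v.choose X.card : ℚ) = v.choose s :=
    mul_left_cancel₀ (mul_ne_zero hW hg0) (by linear_combination h1)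
  have h3 := choose_lt_choose_of_lt_of_two_mul_le hlt (v := v) (by omega)
  have h4 : v.choose X.card = v.choose s := by exact_mod_cast h2
  omega

/-- The Wilson polynomial of a tight design splits into linear factors with integer roots. -/
lemma IsNontrivialTightDesign.exists_wilson_eq_prod (hd : IsNontrivialTightDesign s v k lam B) :
    ∃ X : Finset ℕ, X.card = s ∧ wilson s v k = ∏ y ∈ X, (Polynomial.X - C (y : ℚ)) := by
  have ht := hd.design.t_le_k
  have hkv := hd.design.k_le_v
  have hB : 0 < B.card := by rw [hd.tight]; exact Nat.choose_pos (by omega)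
  obtain ⟨A, hA⟩ := card_pos.1 hB
  obtain ⟨X, hXs, hX⟩ := exists_subset_card_eq (hd.le_card_image hA)
  refine ⟨X, hX, ?_⟩
  refine Polynomial.eq_of_degree_sub_lt_of_eval_index_eq (s := X) (v := fun y : ℕ => (y : ℚ))
    Nat.cast_injective.injOn ?_ fun y hy => ?_
  · have h1 := degree_wilson_sub_lt s v k
    have hm := monic_prod_X_sub_C (fun y : ℕ => (y : ℚ)) X
    have h2 : (descPochhammer ℚ s - ∏ y ∈ X, (Polynomial.X - C (y : ℚ))).degree <
        (s : WithBot ℕ) := by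
      have hs : (descPochhammer ℚ s).degree = (s : WithBot ℕ) := by
        rw [degree_eq_natDegree (monic_descPochhammer ℚ s).ne_zero, descPochhammer_natDegree]
      have hp : (∏ y ∈ X, (Polynomial.X - C (y : ℚ))).degree = (s : WithBot ℕ) := by
        rw [degree_eq_natDegree hm.ne_zero, natDegree_finsetProd_X_sub_C_eq_card, hX]
      rw [← hs]
      exact degree_sub_lt_left (by rw [hs, hp]) (monic_descPochhammer ℚ s).ne_zero
        (by rw [(monic_descPochhammer ℚ s).leadingCoeff, hm.leadingCoeff])
    rw [hX, ← sub_add_sub_cancel _ (descPochhammer ℚ s)]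
    exact (degree_add_le _ _).trans_lt (max_lt h1 h2)
  · obtain ⟨b, hb, rfl⟩ := mem_image.1 (hXs hy)
    obtain ⟨hbA, hb⟩ := mem_erase.1 hb
    rw [hd.wilson_eval_eq_zero hA hb hbA, eval_prod]
    exact (prod_eq_zero hy (by simp)).symm

lemma IsNontrivialTightDesign.exists_wilsonCoeff_eq (hd : IsNontrivialTightDesign s v k lam B)
    {h : ℕ} (hh : h ≤ s) : ∃ d : ℤ, wilsonCoeff s v k h = d := by
  obtain ⟨X, hX, hW⟩ := hd.exists_wilson_eq_prod
  obtain ⟨d, hd2⟩ := exists_eq_sum_descPochhammer s (∏ y ∈ X, (Polynomial.X - C (y : ℤ)))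
    (by rw [natDegree_finsetProd_X_sub_C_eq_card, hX])
  refine ⟨d h, sum_fall_coeff_unique (e := fun j => (d j : ℚ)) (fun x => ?_) hh⟩
  have h1 := congrArg (fun P : ℤ[X] => (P.map (Int.castRingHom ℚ)).eval x) hd2
  simp only [Polynomial.map_prod, Polynomial.map_sub, map_X, map_C, Polynomial.map_sum,
    Polynomial.map_mul, descPochhammer_map, eval_finsetSum, eval_mul, eval_C] at h1
  rw [← wilson_eval, hW]
  simpa [fall] using h1

/-- Integrality of the coefficients of the Wilson polynomial. -/
lemma IsNontrivialTightDesign.descFactorial_dvd (hd : IsNontrivialTightDesign s v k lam B)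
    {h : ℕ} (hh : h < s) : (v - s - h).descFactorial (s - h) ∣
      s.choose h * (k - h).descFactorial (s - h) * (k - 1 - h).descFactorial (s - h) := by
  obtain ⟨d, hd2⟩ := hd.exists_wilsonCoeff_eq hh.le
  have ht := hd.design.t_le_k
  have hkv := hd.design.k_le_v
  have e1 : (v : ℚ) - s - h = ((v - s - h : ℕ) : ℚ) := by
    rw [Nat.cast_sub (by omega), Nat.cast_sub (by omega)]
  have e2 : (k : ℚ) - h = ((k - h : ℕ) : ℚ) := by rw [Nat.cast_sub (by omega)]
  have e3 : (k : ℚ) - 1 - h = ((k - 1 - h : ℕ) : ℚ) := by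
    rw [Nat.cast_sub (by omega), Nat.cast_sub (by omega), Nat.cast_one]
  have hne : ((v - s - h).descFactorial (s - h) : ℚ) ≠ 0 := by
    rw [← fall_natCast]; exact fall_nat_ne_zero (by omega)
  rw [wilsonCoeff, e1, e2, e3, fall_natCast, fall_natCast, fall_natCast, div_eq_iff hne] at hd2
  rw [← Int.natCast_dvd_natCast]
  refine ⟨(-1) ^ (s - h) * d, ?_⟩
  have h2 : ((-1 : ℚ) ^ (s - h)) * (-1) ^ (s - h) = 1 := by rw [← mul_pow]; simp
  have h3 : ((s.choose h * (k - h).descFactorial (s - h) * (k - 1 - h).descFactorial (s - h) : ℕ)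
      : ℚ) = (v - s - h).descFactorial (s - h) * ((-1) ^ (s - h) * d) := by
    push_cast
    linear_combination (-1 : ℚ) ^ (s - h) * hd2 - (s.choose h * (k - h).descFactorial (s - h) *
      (k - 1 - h).descFactorial (s - h) : ℚ) * h2
  exact_mod_cast h3

/-- Integrality of the number of blocks through `s + j + 1` points. -/
lemma IsNontrivialTightDesign.factorial_mul_descFactorial_dvd
    (hd : IsNontrivialTightDesign s v k lam B) {j : ℕ} (hj : j < s) :
    s.factorial * (v - s).descFactorial (j + 1) ∣ k.descFactorial (s + j + 1) := by
  have ht := hd.design.t_le_k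
  have hkv := hd.design.k_le_v
  obtain ⟨H, -, hH⟩ := exists_subset_card_eq (s := (univ : Finset V)) (n := s + j + 1)
    (by rw [card_univ, hd.design.card_points]; omega)
  have h1 := hd.design.card_filter_subset_mul (by omega) H hH
  have h2 := Nat.descFactorial_mul_descFactorial (n := v) (k := s) (m := s + j + 1) (by omega)
  rw [show s + j + 1 - s = j + 1 by omega] at h2
  rw [← h2, hd.tight, v.descFactorial_eq_factorial_mul_choose s] at h1
  refine ⟨(B.filter (fun b => H ⊆ b)).card, ?_⟩
  refine Nat.eq_of_mul_eq_mul_left (Nat.choose_pos (n := v) (k := s) (by omega)) ?_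
  rw [← h1]; ring

end TightDesign

/-! ### Valuations of products of consecutive integers -/

section

open Finset

section Valuation

variable {p : ℕ} [hp : Fact p.Prime]

lemma padicValNat_mono_of_dvd {a b : ℕ} (hb : b ≠ 0) (h : a ∣ b) :
    padicValNat p a ≤ padicValNat p b :=
  (padicValNat_dvd_iff_le hb).1 (pow_padicValNat_dvd.trans h)

lemma padicValNat_descFactorial_sub {n a m : ℕ} (h : a + m ≤ n) :
    padicValNat p ((n - a).descFactorial m) = ∑ x ∈ Ico a (a + m), padicValNat p (n - x) := by
  induction m with
  | zero => simp
  | succ m ih =>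
    have h1 : (n - a).descFactorial m ≠ 0 := fun h0 => by
      have := Nat.descFactorial_eq_zero_iff_lt.1 h0; omega
    rw [Nat.descFactorial_succ, padicValNat.mul (by omega) h1, ih (by omega), ← add_assoc,
      sum_Ico_succ_top (by omega), add_comm, Nat.sub_sub]

lemma padicValNat_descFactorial_sub_right {m a b : ℕ} (hm : m < a) (hab : a ≤ b) :
    padicValNat p ((b - 1 - m).descFactorial (b - a))
      = ∑ x ∈ Ico a b, padicValNat p (x - m) := by
  induction b, hab using Nat.le_induction with
  | base => simp
  | succ b hb ih =>
    have h1 : (b - 1 - m).descFactorial (b - a) ≠ 0 := fun h0 => by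
      have := Nat.descFactorial_eq_zero_iff_lt.1 h0; omega
    rw [sum_Ico_succ_top hb, ← ih, show b + 1 - 1 - m = b - 1 - m + 1 by omega,
      show b + 1 - a = b - a + 1 by omega, Nat.succ_descFactorial_succ,
      padicValNat.mul (by omega) h1, show b - 1 - m + 1 = b - m by omega, add_comm]

lemma padicValNat_sub_le {n x y : ℕ} (hxy : x < y) (hy : y < n)
    {e : ℕ} (h1 : e ≤ padicValNat p (n - x)) (h2 : e ≤ padicValNat p (n - y)) :
    e ≤ padicValNat p (y - x) := by
  rw [← padicValNat_dvd_iff_le (by omega)] at *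
  have := Nat.dvd_sub h1 h2
  rwa [show n - x - (n - y) = y - x by omega] at this

lemma padicValNat_factorial_le_sum {n a b : ℕ} (hab : a ≤ b) (hb : b ≤ n) :
    padicValNat p (b - a).factorial ≤ ∑ x ∈ Ico a b, padicValNat p (n - x) := by
  have h1 := padicValNat_descFactorial_sub (p := p) (n := n) (a := a) (m := b - a) (by omega)
  rw [Nat.add_sub_cancel' hab] at h1
  rw [← h1]
  refine padicValNat_mono_of_dvd (fun h0 => ?_) (Nat.factorial_dvd_descFactorial _ _)
  have := Nat.descFactorial_eq_zero_iff_lt.1 h0; omega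

lemma sum_Ico_le_of_forall_le_left {n a m : ℕ} (hm : m < n)
    (hmax : ∀ x ∈ Ico a m, padicValNat p (n - x) ≤ padicValNat p (n - m)) :
    ∑ x ∈ Ico a m, padicValNat p (n - x) ≤ ∑ x ∈ Ico a m, padicValNat p (m - x) :=
  sum_le_sum fun x hx => padicValNat_sub_le (mem_Ico.1 hx).2 hm le_rfl (hmax x hx)

lemma sum_Ico_le_of_forall_le_right {n a b m : ℕ} (hma : m < a) (hb : b ≤ n)
    (hmax : ∀ x ∈ Ico a b, padicValNat p (n - x) ≤ padicValNat p (n - m)) :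
    ∑ x ∈ Ico a b, padicValNat p (n - x) ≤ ∑ x ∈ Ico a b, padicValNat p (x - m) :=
  sum_le_sum fun x hx => padicValNat_sub_le (lt_of_lt_of_le hma (mem_Ico.1 hx).1)
    (lt_of_lt_of_le (mem_Ico.1 hx).2 hb) (hmax x hx) le_rfl

/-- In a product of consecutive integers, remove a factor of maximal valuation: the others have
at most the valuation of a product of two factorials. -/
lemma sum_padicValNat_le_of_max {n a b m : ℕ} (hm : m ∈ Ico a b) (hb : b ≤ n)
    (hmax : ∀ x ∈ Ico a b, padicValNat p (n - x) ≤ padicValNat p (n - m)) :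
    ∑ x ∈ Ico a b, padicValNat p (n - x) ≤ padicValNat p (n - m) +
      padicValNat p (m - a).factorial + padicValNat p (b - 1 - m).factorial := by
  obtain ⟨ham, hmb⟩ := mem_Ico.1 hm
  rw [← sum_Ico_consecutive _ ham hmb.le, sum_eq_sum_Ico_succ_bot hmb]
  have h1 := sum_Ico_le_of_forall_le_left (a := a) (by omega : m < n) fun x hx =>
    hmax x (Ico_subset_Ico_right hmb.le hx)
  have h2 := sum_Ico_le_of_forall_le_right (a := m + 1) (by omega) hb fun x hx =>
    hmax x (Ico_subset_Ico_left (by omega) hx)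
  have h3 := padicValNat_descFactorial_sub (p := p) (n := m) (a := a) (m := m - a) (by omega)
  rw [Nat.add_sub_cancel' ham, Nat.descFactorial_self] at h3
  rw [← h3] at h1
  rw [← padicValNat_descFactorial_sub_right (by omega) hmb,
    show b - (m + 1) = b - 1 - m by omega, Nat.descFactorial_self] at h2
  omega

lemma padicValNat_descFactorial (n m : ℕ) (h : m ≤ n) : padicValNat p (n.descFactorial m)
    = padicValNat p m.factorial + padicValNat p (n.choose m) := by
  rw [Nat.descFactorial_eq_factorial_mul_choose,
    padicValNat.mul m.factorial_ne_zero (Nat.choose_pos h).ne']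

lemma padicValNat_factorial_eq (n m : ℕ) (h : m ≤ n) : padicValNat p n.factorial
    = padicValNat p (n.choose m) + padicValNat p m.factorial +
      padicValNat p (n - m).factorial := by
  rw [← Nat.choose_mul_factorial_mul_factorial h, padicValNat.mul (mul_ne_zero
    (Nat.choose_pos h).ne' m.factorial_ne_zero) (n - m).factorial_ne_zero,
    padicValNat.mul (Nat.choose_pos h).ne' m.factorial_ne_zero]

lemma ell_ne_zero (n : ℕ) : ell n ≠ 0 := by
  simp only [ell, ne_eq, Finset.lcm_eq_zero_iff, mem_range, not_exists, not_and]
  exact fun i _ j hj => (Nat.choose_pos (Nat.lt_succ_iff.1 hj)).ne'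

lemma choose_dvd_ell {a b n : ℕ} (hba : b ≤ a) (han : a ≤ n) : a.choose b ∣ ell n :=
  (Finset.dvd_lcm (f := fun j => a.choose j) (mem_range.2 (Nat.lt_succ_iff.2 hba))).trans
    (Finset.dvd_lcm (f := fun i => (Finset.range (i + 1)).lcm fun j => i.choose j)
      (mem_range.2 (Nat.lt_succ_iff.2 han)))

lemma padicValNat_choose_le_ell {a b n : ℕ} (han : a ≤ n) :
    padicValNat p (a.choose b) ≤ padicValNat p (ell n) := by
  rcases le_or_gt b a with h | h
  · exact padicValNat_mono_of_dvd (ell_ne_zero n) (choose_dvd_ell h han)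
  · simp [Nat.choose_eq_zero_of_lt h]

lemma padicValNat_le_ell {a n : ℕ} (han : a ≤ n) :
    padicValNat p a ≤ padicValNat p (ell n) := by
  simpa using padicValNat_choose_le_ell (p := p) (b := 1) han

end Valuation

section Local

variable {p s v k i : ℕ} [hp : Fact p.Prime]

/-- The main local estimate. Let `e` be the valuation of the factor `v - s - j`. Either the
divisibility `hlam` produces a factor `k - m` with `j ≤ m ≤ s` of valuation nearly `e`, or the most
divisible of the numbers `k, …, k - s - j` lies outside this range; then the valuations in the
range are small and `hwil` bounds `e`. -/
lemma padicValNat_sub_le_sum_min (hk : 2 * s ≤ k) (hv : k + s < v)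
    {j : ℕ} (hj : j < s)
    (hlam : s.factorial * (v - s).descFactorial (j + 1) ∣ k.descFactorial (s + j + 1))
    (hwil : (v - s - j).descFactorial (s - j) ∣
      s.choose j * (k - j).descFactorial (s - j) * (k - 1 - j).descFactorial (s - j)) :
    padicValNat p (v - s - j) ≤
      ∑ x ∈ Ico j (s + 1), min (padicValNat p (v - s - j)) (padicValNat p (k - x)) +
        padicValNat p (s.choose j) + padicValNat p (ell (s - 1)) := by
  have hne : ∀ {a b : ℕ}, b ≤ a → a.descFactorial b ≠ 0 := fun {a b} hab h0 => by
    have := Nat.descFactorial_eq_zero_iff_lt.1 h0; omega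
  set e := padicValNat p (v - s - j) with he
  -- the divisibility hypotheses as inequalities between sums of valuations
  have L : padicValNat p s.factorial + (padicValNat p j.factorial + e)
      ≤ ∑ x ∈ Ico 0 (s + j + 1), padicValNat p (k - x) := by
    have h1 := padicValNat_mono_of_dvd (p := p) (hne (by omega)) hlam
    rw [padicValNat.mul s.factorial_ne_zero (hne (by omega))] at h1
    have h2 := padicValNat_descFactorial_sub (p := p) (n := v - s) (a := 0) (m := j + 1) (by omega)
    have h3 := padicValNat_descFactorial_sub (p := p) (n := k) (a := 0) (m := s + j + 1) (by omega)
    rw [Nat.sub_zero, zero_add, sum_Ico_succ_top (by omega)] at h2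
    rw [Nat.sub_zero, zero_add] at h3
    have h4 := padicValNat_factorial_le_sum (p := p) (n := v - s) (a := 0) (b := j)
      (by omega) (by omega)
    rw [Nat.sub_zero] at h4
    omega
  have W : e + padicValNat p (s - 1 - j).factorial ≤ padicValNat p (s.choose j) +
      (padicValNat p (k - j) + padicValNat p (k - s) +
        2 * ∑ x ∈ Ico (j + 1) s, padicValNat p (k - x)) := by
    have hc : s.choose j ≠ 0 := (Nat.choose_pos hj.le).ne'
    have h1 := padicValNat_mono_of_dvd (p := p)
      (mul_ne_zero (mul_ne_zero hc (hne (by omega))) (hne (by omega))) hwil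
    rw [padicValNat.mul (mul_ne_zero hc (hne (by omega))) (hne (by omega)),
      padicValNat.mul hc (hne (by omega))] at h1
    have h2 := padicValNat_descFactorial_sub (p := p) (n := v - s) (a := j) (m := s - j) (by omega)
    have h3 := padicValNat_descFactorial_sub (p := p) (n := k) (a := j) (m := s - j) (by omega)
    have h4 := padicValNat_descFactorial_sub (p := p) (n := k) (a := j + 1) (m := s - j) (by omega)
    rw [Nat.add_sub_cancel' hj.le, sum_eq_sum_Ico_succ_bot hj] at h2 h3
    rw [show j + 1 + (s - j) = s + 1 by omega, sum_Ico_succ_top (by omega),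
      show k - (j + 1) = k - 1 - j by omega] at h4
    have h5 := padicValNat_factorial_le_sum (p := p) (n := v - s) (a := j + 1) (b := s)
      (by omega) (by omega)
    rw [show s - (j + 1) = s - 1 - j by omega] at h5
    omega
  -- a factor of large valuation in the range suffices
  have big : ∀ m ∈ Ico j (s + 1), min e (padicValNat p (k - m)) ≤
      ∑ x ∈ Ico j (s + 1), min e (padicValNat p (k - x)) := fun m hm =>
    single_le_sum (f := fun x => min e (padicValNat p (k - x))) (fun _ _ => Nat.zero_le _) hm
  -- small valuations in the interior of the range suffice
  have small : ∑ x ∈ Ico (j + 1) s, padicValNat p (k - x) ≤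
      padicValNat p (s - 1 - j).factorial + padicValNat p (ell (s - 1)) →
      e ≤ ∑ x ∈ Ico j (s + 1), min e (padicValNat p (k - x)) +
        padicValNat p (s.choose j) + padicValNat p (ell (s - 1)) := by
    intro hb
    by_cases hall : ∀ x ∈ Ico j (s + 1), padicValNat p (k - x) ≤ e
    · rw [sum_congr rfl fun x hx => min_eq_right (hall x hx), sum_eq_sum_Ico_succ_bot (by omega),
        sum_Ico_succ_top (by omega)]
      omega
    · push Not at hall
      obtain ⟨x, hx, hxe⟩ := hall
      have := big x hx
      rw [min_eq_left hxe.le] at this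
      omega
  obtain ⟨m, hm, hmax⟩ := exists_max_image (Ico 0 (s + j + 1)) (fun x => padicValNat p (k - x))
    ⟨0, by simp⟩
  have hmlt := (mem_Ico.1 hm).2
  rcases lt_or_ge m j with hmj | hjm
  · apply small
    have h1 := sum_Ico_le_of_forall_le_right (p := p) (n := k) (a := j + 1) (b := s) (m := m)
      (by omega) (by omega) fun x hx => hmax x (mem_Ico.2 ⟨by omega, by
        have := (mem_Ico.1 hx).2; omega⟩)
    rw [← padicValNat_descFactorial_sub_right (by omega) (by omega),
      padicValNat_descFactorial _ _ (by omega), show s - (j + 1) = s - 1 - j by omega] at h1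
    have h2 := padicValNat_choose_le_ell (p := p) (a := s - 1 - m) (b := s - 1 - j) (n := s - 1)
      (by omega)
    omega
  rcases lt_or_ge s m with hsm | hms
  · apply small
    have h1 : ∑ x ∈ Ico (j + 1) s, padicValNat p (k - x) ≤
        ∑ x ∈ Ico (j + 1) s, padicValNat p (m - x) := sum_le_sum fun x hx => by
      have hx' := mem_Ico.1 hx
      exact padicValNat_sub_le (by omega) (by omega) le_rfl
        (hmax x (mem_Ico.2 ⟨by omega, by omega⟩))
    have h3 := padicValNat_descFactorial_sub (p := p) (n := m) (a := j + 1) (m := s - 1 - j)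
      (by omega)
    rw [show j + 1 + (s - 1 - j) = s by omega, padicValNat_descFactorial _ _ (by omega)] at h3
    have h2 := padicValNat_choose_le_ell (p := p) (a := m - (j + 1)) (b := s - 1 - j) (n := s - 1)
      (by omega)
    omega
  · have h1 := sum_padicValNat_le_of_max hm (by omega) hmax
    rw [Nat.sub_zero, show s + j + 1 - 1 - m = s - (m - j) by omega] at h1
    have h2 := padicValNat_factorial_eq (p := p) m j hjm
    have h3 := padicValNat_factorial_eq (p := p) s (m - j) (by omega)
    have h4 := big m (mem_Ico.2 ⟨hjm, by omega⟩)
    rcases hms.eq_or_lt with rfl | hms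
    · rw [Nat.choose_symm hjm] at h3
      omega
    · have h5 := padicValNat_choose_le_ell (p := p) (a := m) (b := j) (n := s - 1) (by omega)
      omega

lemma padicValNat_choose_le_pred {j : ℕ} (hj : j < s) :
    padicValNat p (s.choose j) ≤ padicValNat p s + padicValNat p ((s - 1).choose j) := by
  have h1 : s.choose j ∣ s * (s - 1).choose j := by
    refine ⟨s - j, ?_⟩
    obtain ⟨t, rfl⟩ : ∃ t, s = t + 1 := ⟨s - 1, by omega⟩
    have := Nat.choose_mul_succ_eq t j
    simp only [Nat.add_sub_cancel]
    linarith
  rw [← padicValNat.mul (by omega) (Nat.choose_pos (by omega)).ne']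
  exact padicValNat_mono_of_dvd (mul_ne_zero (by omega) (Nat.choose_pos (by omega)).ne') h1

lemma padicValNat_choose_pred_le {j : ℕ} (hs : 2 ≤ s) (hj : j < s) :
    padicValNat p ((s - 1).choose j) ≤ padicValNat p (s - 1) + padicValNat p (ell (s - 2)) := by
  rcases (Nat.le_sub_one_of_lt hj).eq_or_lt with rfl | hlt
  · simp
  · have h1 := padicValNat_choose_le_pred (p := p) hlt
    have h2 := padicValNat_choose_le_ell (p := p) (a := s - 1 - 1) (b := j) (n := s - 2) (by omega)
    omega

lemma min_padicValNat_le {j x : ℕ} (hks : x ≤ s) (hjx : j ≤ x) (hk : 2 * s ≤ k)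
    (hv : k + s < v) :
    min (padicValNat p (v - s - j)) (padicValNat p (k - x)) ≤
      padicValNat p (v - k - s + (x - j)) := by
  rw [← padicValNat_dvd_iff_le (by omega)]
  have h1 : p ^ min (padicValNat p (v - s - j)) (padicValNat p (k - x)) ∣ v - s - j :=
    (pow_dvd_pow _ (min_le_left _ _)).trans pow_padicValNat_dvd
  have h2 : p ^ min (padicValNat p (v - s - j)) (padicValNat p (k - x)) ∣ k - x :=
    (pow_dvd_pow _ (min_le_right _ _)).trans pow_padicValNat_dvd
  have := Nat.dvd_sub h1 h2
  rwa [show v - s - j - (k - x) = v - k - s + (x - j) by omega] at this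

/-- Modulo a common divisor of `v - s - j` and `k - x`, the factor `k - x` may be replaced by
`v - k - s + (x - j)`. -/
lemma sum_min_Ico_le {j c : ℕ} (hc : c ≤ s) (hcj : c ≤ j + i) (hk : 2 * s ≤ k)
    (hv : k + s < v) :
    ∑ x ∈ Ico j c, min (padicValNat p (v - s - j)) (padicValNat p (k - x)) ≤
      ∑ u ∈ range i, padicValNat p (v - k - s + u) := by
  rcases lt_or_ge j c with hjc | hjc
  · refine (sum_le_sum fun x hx => min_padicValNat_le (by have := (mem_Ico.1 hx).2; omega)
      (mem_Ico.1 hx).1 hk hv).trans ?_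
    rw [sum_Ico_eq_sum_range]
    simp only [Nat.add_sub_cancel_left]
    exact sum_le_sum_of_subset (range_subset_range.2 (by omega))
  · simp [Ico_eq_empty_of_le hjc]

/-- The valuations of the falling factorials in the denominator and the numerator of `Gtilde`, for
`i = r / 2`. Most of `2 * val (s!)` is spent on the denominators without their most divisible
factors, the rest and `ell` on the loss in `padicValNat_sub_le_sum_min`. -/
lemma padicValNat_sum_le (hi : 1 ≤ i) (his : 2 * i ≤ s) (hk : 2 * s ≤ k) (hv : k + s < v)
    (hlam : ∀ j < s, s.factorial * (v - s).descFactorial (j + 1) ∣ k.descFactorial (s + j + 1))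
    (hwil : ∀ j < s, (v - s - j).descFactorial (s - j) ∣
      s.choose j * (k - j).descFactorial (s - j) * (k - 1 - j).descFactorial (s - j)) :
    ∑ x ∈ Ico 0 s, padicValNat p (v - s - x) + ∑ x ∈ Ico i s, padicValNat p (v - s - x) ≤
      2 * padicValNat p s.factorial + 2 * padicValNat p (ell (s - 1)) +
      2 * padicValNat p (ell (s - 2)) + ∑ u ∈ range i, padicValNat p (v - k - s + u) +
      ∑ x ∈ Ico i (s + 1), padicValNat p (k - x) +
      ∑ x ∈ Ico (2 * i) (s + 1), padicValNat p (k - x) := by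
  obtain ⟨j, hj, hmax⟩ := exists_max_image (Ico 0 s) (fun x => padicValNat p (v - s - x))
    ⟨0, by simp; omega⟩
  have hjs := (mem_Ico.1 hj).2
  have key := padicValNat_sub_le_sum_min (p := p) hk hv hjs (hlam j hjs) (hwil j hjs)
  have D1 := sum_padicValNat_le_of_max hj (by omega) hmax
  have c1 := padicValNat_choose_le_pred (p := p) hjs
  have c2 := padicValNat_choose_pred_le (p := p) (by omega) hjs
  have f1 : padicValNat p s.factorial = padicValNat p s + padicValNat p (s - 1).factorial := by
    rw [← Nat.mul_factorial_pred (by omega : s ≠ 0),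
      padicValNat.mul (by omega) (Nat.factorial_ne_zero _)]
  have f2 : padicValNat p (s - 1).factorial =
      padicValNat p (s - 1) + padicValNat p (s - 2).factorial := by
    rw [← Nat.mul_factorial_pred (by omega : s - 1 ≠ 0),
      padicValNat.mul (by omega) (Nat.factorial_ne_zero _), show s - 1 - 1 = s - 2 by omega]
  have f3 := padicValNat_factorial_eq (p := p) (s - 1) j (by omega)
  rw [Nat.sub_zero] at D1
  -- the second denominator, with its most divisible factor removed
  have D2 : ∀ j' ∈ Ico i s, (∀ x ∈ Ico i s, padicValNat p (v - s - x) ≤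
      padicValNat p (v - s - j')) → ∑ x ∈ Ico i s, padicValNat p (v - s - x) ≤
      padicValNat p (v - s - j') + padicValNat p (s - 2).factorial := by
    intro j' hj' hmax'
    obtain ⟨h1, h2⟩ := mem_Ico.1 hj'
    have h3 := sum_padicValNat_le_of_max hj' (by omega) hmax'
    have h4 := padicValNat_factorial_eq (p := p) (s - 1 - i) (j' - i) (by omega)
    rw [show s - 1 - i - (j' - i) = s - 1 - j' by omega] at h4
    have h5 := padicValNat_mono_of_dvd (p := p) (s - 2).factorial_ne_zero
      (Nat.factorial_dvd_factorial (by omega : s - 1 - i ≤ s - 2))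
    omega
  rcases lt_or_ge j i with hji | hij
  · obtain ⟨j', hj', hmax'⟩ := exists_max_image (Ico i s) (fun x => padicValNat p (v - s - x))
      ⟨i, by simp; omega⟩
    have d2 := D2 j' hj' hmax'
    obtain ⟨h1, h2⟩ := mem_Ico.1 hj'
    -- both `v - s - j` and `v - s - j'` are divisible by the smaller prime power
    have h3 := (padicValNat_sub_le (by omega : j < j') (by omega)
      (hmax j' (mem_Ico.2 ⟨by omega, h2⟩)) le_rfl).trans
      (padicValNat_le_ell (p := p) (by omega : j' - j ≤ s - 1))
    -- the factors `k - x` with `j ≤ x < i` are replaced, those with `i ≤ x ≤ s` are in the numerator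
    have h4 := sum_min_Ico_le (p := p) (i := i) (j := j) (c := i) (by omega) (by omega) hk hv
    have h5 : ∑ x ∈ Ico i (s + 1), min (padicValNat p (v - s - j)) (padicValNat p (k - x)) ≤
        ∑ x ∈ Ico i (s + 1), padicValNat p (k - x) := sum_le_sum fun _ _ => min_le_right _ _
    rw [← sum_Ico_consecutive _ hji.le (by omega : i ≤ s + 1)] at key
    omega
  -- `v - s - j` occurs in both denominators, so the estimate is used twice
  · have d2 := D2 j (mem_Ico.2 ⟨hij, hjs⟩) fun x hx =>
      hmax x (Ico_subset_Ico_left (by omega) hx)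
    have h1 : ∑ x ∈ Ico j (s + 1), min (padicValNat p (v - s - j)) (padicValNat p (k - x)) ≤
        ∑ x ∈ Ico i (s + 1), padicValNat p (k - x) :=
      (sum_le_sum fun _ _ => min_le_right _ _).trans
        (sum_le_sum_of_subset (Ico_subset_Ico_left hij))
    have h2 : ∑ x ∈ Ico j (s + 1), min (padicValNat p (v - s - j)) (padicValNat p (k - x)) ≤
        ∑ u ∈ range i, padicValNat p (v - k - s + u) +
          ∑ x ∈ Ico (2 * i) (s + 1), padicValNat p (k - x) := by
      rcases le_or_gt (2 * i) j with h | h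
      · exact ((sum_le_sum fun _ _ => min_le_right _ _).trans
          (sum_le_sum_of_subset (Ico_subset_Ico_left h))).trans (Nat.le_add_left _ _)
      · rw [← sum_Ico_consecutive _ h.le (by omega : 2 * i ≤ s + 1)]
        exact add_le_add (sum_min_Ico_le his (by omega) hk hv)
          (sum_le_sum fun _ _ => min_le_right _ _)
    omega

end Local

end

/-! ### Comparison with the constants of the statement -/

section Global

open Finset

variable {s v k i : ℕ}

lemma padicValNat_Ftilde (p : ℕ) [Fact p.Prime] (s r : ℕ) : padicValNat p (Ftilde s r) =
    padicValNat p s.factorial + padicValNat p r.factorial + 2 * padicValNat p (ell (s - 1)) +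
      2 * padicValNat p (ell (s - 2)) + padicValNat p (s - r + 1).factorial +
      padicValNat p (s - r / 2 + 1) := by
  have h1 := pow_ne_zero 2 (ell_ne_zero (s - 1))
  have h2 := pow_ne_zero 2 (ell_ne_zero (s - 2))
  have h3 := mul_ne_zero s.factorial_ne_zero r.factorial_ne_zero
  have h5 := (s - r + 1).factorial_ne_zero
  rw [Ftilde, padicValNat.mul (by positivity) (by omega), padicValNat.mul (by positivity) h5,
    padicValNat.mul (by positivity) h2, padicValNat.mul h3 h1,
    padicValNat.mul s.factorial_ne_zero r.factorial_ne_zero, padicValNat.pow,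
    padicValNat.pow]

lemma padicValNat_ell_eq_zero {p n : ℕ} [hp : Fact p.Prime] (h : n < p) :
    padicValNat p (ell n) = 0 := by
  refine padicValNat.eq_zero_of_not_dvd fun hdvd => ?_
  have h1 : ell n ∣ n.factorial := by
    refine Finset.lcm_dvd fun a ha => Finset.lcm_dvd fun b hb => ?_
    have ha := mem_range.1 ha
    have hb := mem_range.1 hb
    have hc : a.choose b ∣ a.factorial :=
      ⟨b.factorial * (a - b).factorial, by
        rw [← mul_assoc, Nat.choose_mul_factorial_mul_factorial (by omega)]⟩
    exact hc.trans (Nat.factorial_dvd_factorial (by omega))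
  exact absurd ((hp.out.dvd_factorial).1 (hdvd.trans h1)) (by omega)

lemma padicValNat_Ftilde_eq_zero {p : ℕ} [hp : Fact p.Prime] {r : ℕ} (hr : 2 ≤ r) (hrs : r ≤ s)
    (h : s < p) : padicValNat p (Ftilde s r) = 0 := by
  have hf : ∀ m < p, padicValNat p m.factorial = 0 := fun m hm =>
    padicValNat.eq_zero_of_not_dvd fun hdvd => absurd ((hp.out.dvd_factorial).1 hdvd) (by omega)
  have h1 : padicValNat p (s - r / 2 + 1) = 0 := padicValNat.eq_zero_of_not_dvd fun hdvd =>
    absurd (Nat.le_of_dvd (by omega) hdvd) (by omega)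
  rw [padicValNat_Ftilde, hf _ h, hf _ (by omega), hf _ (by omega), h1,
    padicValNat_ell_eq_zero (by omega), padicValNat_ell_eq_zero (by omega)]

/-- The `p`-part of the integrality of `Ftilde * Gtilde`, in terms of falling factorials: the
factorials hidden in the binomial coefficients of `Gtilde` cancel against those of `Ftilde`. -/
lemma padicValNat_den_le {p : ℕ} [hp : Fact p.Prime] (hi : 1 ≤ i) (his : 2 * i ≤ s)
    (hk : 2 * s ≤ k) (hv : k + s < v)
    (hlam : ∀ j < s, s.factorial * (v - s).descFactorial (j + 1) ∣ k.descFactorial (s + j + 1))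
    (hwil : ∀ j < s, (v - s - j).descFactorial (s - j) ∣
      s.choose j * (k - j).descFactorial (s - j) * (k - 1 - j).descFactorial (s - j)) :
    padicValNat p ((v - s).choose s) + padicValNat p ((v - s - i).choose (s - i)) ≤
      padicValNat p (Ftilde s (2 * i)) + padicValNat p ((v - k - s + i - 1).choose i) +
        padicValNat p ((k - i).choose (s - i + 1)) +
        padicValNat p ((k - 2 * i).choose (s - 2 * i + 1)) := by
  have main := padicValNat_sum_le (p := p) hi his hk hv hlam hwil
  have a1 := padicValNat_descFactorial_sub (p := p) (n := v - s) (a := 0) (m := s) (by omega)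
  have a2 := padicValNat_descFactorial_sub (p := p) (n := v - s) (a := i) (m := s - i) (by omega)
  have a3 := padicValNat_descFactorial_sub (p := p) (n := k) (a := i) (m := s - i + 1) (by omega)
  have a4 := padicValNat_descFactorial_sub (p := p) (n := k) (a := 2 * i) (m := s - 2 * i + 1)
    (by omega)
  have a5 := padicValNat_descFactorial_sub_right (p := p) (m := 0) (a := v - k - s)
    (b := v - k - s + i) (by omega) (by omega)
  rw [sum_Ico_eq_sum_range] at a5
  simp only [Nat.add_sub_cancel_left, Nat.sub_zero] at a5
  rw [Nat.sub_zero, zero_add] at a1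
  rw [show i + (s - i) = s by omega] at a2
  rw [show i + (s - i + 1) = s + 1 by omega] at a3
  rw [show 2 * i + (s - 2 * i + 1) = s + 1 by omega] at a4
  rw [padicValNat_descFactorial _ _ (by omega)] at a1 a2 a3 a4 a5
  have f1 : padicValNat p (s - i + 1).factorial =
      padicValNat p (s - i + 1) + padicValNat p (s - i).factorial := by
    rw [Nat.factorial_succ, padicValNat.mul (by omega) (Nat.factorial_ne_zero _)]
  have f2 := padicValNat_mono_of_dvd (p := p) (2 * i).factorial_ne_zero
    (Nat.factorial_dvd_factorial (by omega : i ≤ 2 * i))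
  rw [padicValNat_Ftilde, Nat.mul_div_cancel_left _ two_pos]
  omega

lemma FtildeCap_ne_zero (b : ℝ) (s r v : ℕ) : FtildeCap b s r v ≠ 0 :=
  mul_ne_zero (prod_ne_zero_iff.2 fun _ hp => pow_ne_zero _ (mem_filter.1 hp).2.ne_zero)
    (prod_ne_zero_iff.2 fun _ hp => pow_ne_zero _ (mem_filter.1 hp).2.ne_zero)

lemma two_mul_log_le_padicValNat_FtildeCap {b : ℝ} {p : ℕ} [hp : Fact p.Prime]
    (h : p ≤ ⌊b⌋₊) (s r v : ℕ) : 2 * Nat.log p (v - s) ≤ padicValNat p (FtildeCap b s r v) := by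
  rw [← padicValNat_dvd_iff_le (FtildeCap_ne_zero b s r v)]
  exact Dvd.dvd.mul_right (dvd_prod_of_mem (fun p => p ^ (2 * Nat.log p (v - s)))
    (mem_filter.2 ⟨mem_Icc.2 ⟨hp.out.two_le, h⟩, hp.out⟩)) _

lemma padicValNat_Ftilde_le_padicValNat_FtildeCap {b : ℝ} {p : ℕ} [hp : Fact p.Prime]
    (h : ⌊b⌋₊ < p) {r : ℕ} (hr : 2 ≤ r) (hrs : r ≤ s) (v : ℕ) :
    padicValNat p (Ftilde s r) ≤ padicValNat p (FtildeCap b s r v) := by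
  rcases lt_or_ge s p with hsp | hps
  · rw [padicValNat_Ftilde_eq_zero hr hrs hsp]
    exact Nat.zero_le _
  · rw [← padicValNat_dvd_iff_le (FtildeCap_ne_zero b s r v)]
    exact Dvd.dvd.mul_left (dvd_prod_of_mem (fun p => p ^ padicValNat p (Ftilde s r))
      (mem_filter.2 ⟨mem_Ioc.2 ⟨h, hps⟩, hp.out⟩)) _

lemma padicValNat_choose_le_log {p : ℕ} (hp : p.Prime) (n m : ℕ) :
    padicValNat p (n.choose m) ≤ Nat.log p n := by
  rw [← Nat.factorization_def _ hp]
  exact Nat.factorization_choose_le_log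

end Global

/-! ### Integrality of the product -/

theorem proposition4p1 (s r v k lam : ℕ) (b : ℝ) (hr_even : Even r) (hr_pos : 0 < r)
    (hrs : r ≤ s)
    (hdesign : ∃ (V : Type) (_ : Fintype V) (_ : DecidableEq V) (B : Finset (Finset V)),
      IsNontrivialTightDesign s v k lam B) :
    ∃ n : ℕ, 0 < n ∧ (FtildeCap b s r v : ℚ) * Gtilde s r v k = (n : ℚ) := by
  obtain ⟨V, _, _, B, hd⟩ := hdesign
  obtain ⟨i, rfl⟩ := even_iff_exists_two_mul.1 hr_even
  have hk := hd.design.t_le_k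
  have hkv := hd.design.k_le_v
  have hv : k + s < v := by have := hd.lt_sub; omega
  have hN1 : (v - k - s + i - 1).choose i ≠ 0 := (Nat.choose_pos (by omega)).ne'
  have hN2 : (k - i).choose (s - i + 1) ≠ 0 := (Nat.choose_pos (by omega)).ne'
  have hN3 : (k - 2 * i).choose (s - 2 * i + 1) ≠ 0 := (Nat.choose_pos (by omega)).ne'
  have hD1 : (v - s).choose s ≠ 0 := (Nat.choose_pos (by omega)).ne'
  have hD2 : (v - s - i).choose (s - i) ≠ 0 := (Nat.choose_pos (by omega)).ne'
  have hF := FtildeCap_ne_zero b s (2 * i) v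
  have hdvd : (v - s).choose s * (v - s - i).choose (s - i) ∣
      FtildeCap b s (2 * i) v * ((v - k - s + i - 1).choose i * (k - i).choose (s - i + 1) *
        (k - 2 * i).choose (s - 2 * i + 1)) := by
    rw [← Nat.factorization_prime_le_iff_dvd (by positivity) (by positivity)]
    intro p hp
    have : Fact p.Prime := ⟨hp⟩
    rw [Nat.factorization_def _ hp, Nat.factorization_def _ hp, padicValNat.mul hD1 hD2,
      padicValNat.mul hF (by positivity), padicValNat.mul (by positivity) hN3,
      padicValNat.mul hN1 hN2]
    rcases le_or_gt p ⌊b⌋₊ with h | h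
    · have h1 := two_mul_log_le_padicValNat_FtildeCap h s (2 * i) v
      have h2 := padicValNat_choose_le_log hp (v - s) s
      have h3 := (padicValNat_choose_le_log hp (v - s - i) (s - i)).trans
        (Nat.log_mono_right (Nat.sub_le (v - s) i))
      omega
    · have h1 := padicValNat_Ftilde_le_padicValNat_FtildeCap h (by omega) hrs v
      have h2 := padicValNat_den_le (p := p) (by omega) hrs hk hv
        (fun j hj => hd.factorial_mul_descFactorial_dvd hj) fun j hj => hd.descFactorial_dvd hj
      omega
  obtain ⟨n, hn⟩ := hdvd
  refine ⟨n, Nat.pos_of_ne_zero ?_, ?_⟩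
  · rintro rfl
    rw [mul_zero] at hn
    exact (by positivity : FtildeCap b s (2 * i) v * ((v - k - s + i - 1).choose i *
      (k - i).choose (s - i + 1) * (k - 2 * i).choose (s - 2 * i + 1)) ≠ 0) hn
  · have hD : ((v - s).choose s : ℚ) * ((v - s - i).choose (s - i) : ℚ) ≠ 0 :=
      mul_ne_zero (by exact_mod_cast hD1) (by exact_mod_cast hD2)
    rw [Gtilde, Nat.mul_div_cancel_left _ two_pos, ← mul_div_assoc, div_eq_iff hD, mul_comm (n : ℚ)]
    exact_mod_cast hn
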